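/- Every $t\in(0,1]$ has a unique dyadic expansion $t=\sum_{n\ge 0} t_n 2^{-(n+1)}$, $t_n\in\{0,1\}$, that does not end in zeros; for $t=0$ put $t_n=0$ for all $n$. The baker's transformation $B=(B_1,B_2)$ of $[0,1]^2$ moves the first digit of the first component to the front of the second one: $$B(\xi,x)=\Big(\sum_{n\ge 0}\xi_{n+1}2^{-(n+1)},\ \frac{\xi_0+x}{2}\Big)=\Big(2\xi-\xi_0,\ \frac{\xi_0+x}{2}\Big).$$ Let $B^n=(B^n_1,B^n_2)$ be its $n$-th iterate, and for $0<\kappa<1$ and $\xi,x\in[0,1]$ let $$S(\xi,x)=2\pi\sum_{n=1}^\infty \kappa^n\sin\big(2\pi B_2^n(\xi,x)\big).$$ **Proposition.** There exists $\kappa_0\in[0.55,0.56]$ such that for every $\kappa$ with $0<\kappa\le\kappa_0$ the following holds. For every $\xi\in[0,1]$ the function $S(\xi,\cdot)$ is differentiable on $[0,1]$ (one-sidedly at the endpoints), with derivative denoted by $S'(\xi,\cdot)$, and the vectors $$V_{\xi,\eta}(x)=\big(S(\xi,x)-S(\eta,x),\ S'(\xi,x)-S'(\eta,x)\big)\in\mathbb{R}^2$$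 satisfy $\inf_{x\in[0,1]}|V_{\xi,\eta}(x)|>0$ uniformly on $\{|\xi-\eta|>\frac12\}$: there is a constant $c>0$ such that $\inf_{x\in[0,1]}|V_{\xi,\eta}(x)|\ge c$ for all $\xi,\eta\in[0,1]$ with $|\xi-\eta|>\frac12$. Here $|\cdot|$ is the Euclidean norm. -/

import Mathlib

open Set Filter Topology

noncomputable section

namespace Weierstrass

/-- The `n`-th digit (`n = 0, 1, …`, with weight `2⁻⁽ⁿ⁺¹⁾`) of the dyadic expansion of `t ∈ [0,1]`.
A dyadic rational `t ≠ 0` gets the expansion that does not end in zeros; `0` gets the zero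
sequence. See `hasSum_digit` and `exists_digit_eq_one`. -/
def digit (t : ℝ) (n : ℕ) : Fin 2 :=
  if 0 < t ∧ Even ⌈(2 : ℝ) ^ (n + 1) * t⌉ then 1 else 0

theorem sum_digit {t : ℝ} (h0 : 0 < t) (h1 : t ≤ 1) (N : ℕ) :
    ∑ n ∈ Finset.range N, ((digit t n : ℕ) : ℝ) / 2 ^ (n + 1)
      = ((⌈(2 : ℝ) ^ N * t⌉ : ℝ) - 1) / 2 ^ N := by
  induction N with
  | zero =>
    have : ⌈t⌉ = 1 := by
      rw [Int.ceil_eq_iff]; constructor <;> push_cast <;> linarith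
    simp [this]
  | succ N ih =>
    rw [Finset.sum_range_succ, ih]
    set m := ⌈(2 : ℝ) ^ (N + 1) * t⌉ with hm
    have hm' := (Int.ceil_eq_iff (a := (2 : ℝ) ^ (N + 1) * t) (z := m)).1 hm.symm
    rw [pow_succ] at hm'
    have hp : (0 : ℝ) < 2 ^ N := by positivity
    rcases Int.even_or_odd m with he | ho
    · have hd : digit t N = 1 := by simp [digit, h0, ← hm, he]
      obtain ⟨k, hk⟩ := he
      have hk' : (m : ℝ) = k + k := by exact_mod_cast hk
      have hc : ⌈(2 : ℝ) ^ N * t⌉ = k := by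
        rw [Int.ceil_eq_iff]; constructor <;> nlinarith [hm'.1, hm'.2]
      rw [hd, hc, hk', pow_succ]
      field_simp
      norm_num
      ring
    · have hd : digit t N = 0 := by
        have : ¬ Even m := by simpa using ho
        simp [digit, ← hm, this]
      obtain ⟨k, hk⟩ := ho
      have hk' : (m : ℝ) = 2 * k + 1 := by exact_mod_cast hk
      have hc : ⌈(2 : ℝ) ^ N * t⌉ = k + 1 := by
        rw [Int.ceil_eq_iff]; constructor <;> push_cast <;> nlinarith [hm'.1, hm'.2]
      rw [hd, hc, hk', pow_succ]
      push_cast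
      field_simp
      norm_num

theorem digit_zero_left (n : ℕ) : digit 0 n = 0 := by simp [digit]

/-- The digits of `t ∈ [0,1]` represent `t`. -/
theorem hasSum_digit {t : ℝ} (ht : t ∈ Icc (0 : ℝ) 1) :
    HasSum (fun n : ℕ => ((digit t n : ℕ) : ℝ) / 2 ^ (n + 1)) t := by
  rcases ht.1.eq_or_lt with h | h0
  · subst h; simp [digit_zero_left]
  rw [hasSum_iff_tendsto_nat_of_nonneg (fun n => by positivity)]
  simp_rw [sum_digit h0 ht.2]
  have hlim : Tendsto (fun N : ℕ => t - (1 / 2 : ℝ) ^ N) atTop (𝓝 t) := by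
    simpa using (tendsto_pow_atTop_nhds_zero_of_lt_one (r := (1 / 2 : ℝ))
      (by norm_num) (by norm_num)).const_sub t
  refine tendsto_of_tendsto_of_tendsto_of_le_of_le hlim tendsto_const_nhds ?_ ?_
  · intro N
    have hp : (0 : ℝ) < 2 ^ N := by positivity
    have := Int.le_ceil ((2 : ℝ) ^ N * t)
    show t - (1 / 2 : ℝ) ^ N ≤ _
    rw [le_div_iff₀ hp, sub_mul, ← mul_pow]
    norm_num
    linarith
  · intro N
    have hp : (0 : ℝ) < 2 ^ N := by positivity
    have := Int.ceil_lt_add_one ((2 : ℝ) ^ N * t)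
    show _ ≤ t
    rw [div_le_iff₀ hp]
    linarith

/-- The expansion chosen for `t ∈ (0,1]` does not end in zeros. -/
theorem exists_digit_eq_one {t : ℝ} (ht : t ∈ Ioc (0 : ℝ) 1) (N : ℕ) :
    ∃ n ≥ N, digit t n = 1 := by
  by_contra! h
  have hz : ∀ n ≥ N, digit t n = 0 := fun n hn => by
    have := h n hn
    omega
  have h1 : HasSum (fun n : ℕ => ((digit t n : ℕ) : ℝ) / 2 ^ (n + 1))
      (∑ n ∈ Finset.range N, ((digit t n : ℕ) : ℝ) / 2 ^ (n + 1)) :=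
    hasSum_sum_of_ne_finset_zero fun n hn => by
      have : N ≤ n := by simpa using hn
      simp [hz n this]
  have h2 := h1.unique (hasSum_digit ⟨ht.1.le, ht.2⟩)
  rw [sum_digit ht.1 ht.2] at h2
  have hp : (0 : ℝ) < 2 ^ N := by positivity
  have := Int.ceil_lt_add_one ((2 : ℝ) ^ N * t)
  rw [div_eq_iff hp.ne'] at h2
  linarith

/-- The map sending a two-sided sequence of digits `ω` to the pair
`(∑_{n ≥ 0} ω₋ₙ 2⁻⁽ⁿ⁺¹⁾, ∑_{n ≥ 1} ωₙ 2⁻ⁿ)`. -/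
def T (ω : ℤ → Fin 2) : ℝ × ℝ :=
  (∑' n : ℕ, ((ω (-(n : ℤ)) : ℕ) : ℝ) / 2 ^ (n + 1),
   ∑' n : ℕ, ((ω ((n : ℤ) + 1) : ℕ) : ℝ) / 2 ^ (n + 1))

/-- The inverse of `T`: the digits of `ξ` stand at the places `0, -1, -2, …`,
those of `x` at the places `1, 2, …`. -/
def Tinv (p : ℝ × ℝ) (k : ℤ) : Fin 2 :=
  if k ≤ 0 then digit p.1 (-k).toNat else digit p.2 (k - 1).toNat

/-- The shift that carries the digit at place `0` (the first digit of `ξ`) to place `1`. -/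
def shift (ω : ℤ → Fin 2) (k : ℤ) : Fin 2 := ω (k - 1)

/-- The baker's transformation of the unit square. -/
def baker (p : ℝ × ℝ) : ℝ × ℝ := T (shift (Tinv p))

theorem Tinv_neg (p : ℝ × ℝ) (n : ℕ) : Tinv p (-(n : ℤ)) = digit p.1 n := by
  simp [Tinv]

theorem Tinv_pos (p : ℝ × ℝ) (n : ℕ) : Tinv p ((n : ℤ) + 1) = digit p.2 n := by
  have : ¬ ((n : ℤ) + 1 ≤ 0) := by omega
  simp [Tinv, this]

theorem T_Tinv {p : ℝ × ℝ} (h₁ : p.1 ∈ Icc (0 : ℝ) 1) (h₂ : p.2 ∈ Icc (0 : ℝ) 1) :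
    T (Tinv p) = p := by
  simp only [T, Tinv_neg, Tinv_pos, (hasSum_digit h₁).tsum_eq, (hasSum_digit h₂).tsum_eq]

theorem digit_zero {t : ℝ} (ht : t ∈ Icc (0 : ℝ) 1) :
    digit t 0 = if 1 / 2 < t then 1 else 0 := by
  rcases ht.1.eq_or_lt with h | h0
  · subst h; norm_num [digit]
  split_ifs with h
  · have : ⌈(2 : ℝ) ^ (0 + 1) * t⌉ = 2 := by
      rw [Int.ceil_eq_iff]; constructor <;> norm_num <;> linarith [ht.2]
    simp only [digit, this]
    simp [h0]
  · have : ⌈(2 : ℝ) ^ (0 + 1) * t⌉ = 1 := by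
      rw [Int.ceil_eq_iff]; constructor <;> norm_num <;> linarith
    simp only [digit, this]
    simp

/-- The action of the baker's transformation on the unit square. -/
theorem baker_eq {ξ x : ℝ} (hξ : ξ ∈ Icc (0 : ℝ) 1) (hx : x ∈ Icc (0 : ℝ) 1) :
    baker (ξ, x) = if 1 / 2 < ξ then (2 * ξ - 1, (x + 1) / 2) else (2 * ξ, x / 2) := by
  have e1 : ∀ n : ℕ, shift (Tinv (ξ, x)) (-(n : ℤ)) = digit ξ (n + 1) := fun n => by
    have := Tinv_neg (ξ, x) (n + 1)
    rw [shift, ← this]; congr 1; push_cast; ring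
  have e2 : ∀ n : ℕ, shift (Tinv (ξ, x)) (((n + 1 : ℕ) : ℤ) + 1) = digit x n := fun n => by
    have := Tinv_pos (ξ, x) n
    rw [shift, ← this]; congr 1; push_cast; ring
  have e3 : shift (Tinv (ξ, x)) (((0 : ℕ) : ℤ) + 1) = digit ξ 0 := by
    simp [shift, Tinv]
  have s1 : HasSum (fun n : ℕ => ((shift (Tinv (ξ, x)) (-(n : ℤ)) : ℕ) : ℝ) / 2 ^ (n + 1))
      (2 * ξ - (digit ξ 0 : ℕ)) := by
    have h := ((hasSum_nat_add_iff' 1).2 (hasSum_digit hξ)).mul_left 2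
    have hf : (fun n : ℕ => ((shift (Tinv (ξ, x)) (-(n : ℤ)) : ℕ) : ℝ) / 2 ^ (n + 1))
        = fun n : ℕ => 2 * (((digit ξ (n + 1) : ℕ) : ℝ) / 2 ^ (n + 1 + 1)) := by
      funext n; rw [e1, pow_succ _ (n + 1)]; field_simp
    have hv : 2 * ξ - ((digit ξ 0 : ℕ) : ℝ)
        = 2 * (ξ - ∑ n ∈ Finset.range 1, ((digit ξ n : ℕ) : ℝ) / 2 ^ (n + 1)) := by
      simp only [Finset.sum_range_one]; ring
    rw [hf, hv]; exact h
  have s2 : HasSum (fun n : ℕ => ((shift (Tinv (ξ, x)) ((n : ℤ) + 1) : ℕ) : ℝ) / 2 ^ (n + 1))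
      ((x + (digit ξ 0 : ℕ)) / 2) := by
    rw [← hasSum_nat_add_iff' 1]
    have hf : (fun n : ℕ => ((shift (Tinv (ξ, x)) (((n + 1 : ℕ) : ℤ) + 1) : ℕ) : ℝ)
          / 2 ^ (n + 1 + 1)) = fun n : ℕ => 1 / 2 * (((digit x n : ℕ) : ℝ) / 2 ^ (n + 1)) := by
      funext n; rw [e2, pow_succ _ (n + 1)]; field_simp
    have hv : (x + ((digit ξ 0 : ℕ) : ℝ)) / 2 - ∑ n ∈ Finset.range 1,
          ((shift (Tinv (ξ, x)) ((n : ℤ) + 1) : ℕ) : ℝ) / 2 ^ (n + 1) = 1 / 2 * x := by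
      simp only [Finset.sum_range_one, e3]; ring
    rw [hf, hv]; exact (hasSum_digit hx).mul_left (1 / 2)
  rw [baker, T, s1.tsum_eq, s2.tsum_eq, digit_zero hξ]
  split_ifs <;> simp

/-- `S(ξ, x) = 2π ∑_{n ≥ 1} κⁿ sin(2π B₂ⁿ(ξ, x))`, where `B` is the baker's transformation. -/
def S (κ ξ x : ℝ) : ℝ :=
  2 * Real.pi * ∑' n : ℕ, κ ^ (n + 1) * Real.sin (2 * Real.pi * (baker^[n + 1] (ξ, x)).2)

theorem summable_S {κ : ℝ} (h0 : 0 < κ) (h1 : κ < 1) (ξ x : ℝ) :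
    Summable fun n : ℕ =>
      κ ^ (n + 1) * Real.sin (2 * Real.pi * (baker^[n + 1] (ξ, x)).2) := by
  refine Summable.of_norm_bounded
    ((summable_nat_add_iff 1).2 (summable_geometric_of_lt_one h0.le h1)) fun n => ?_
  rw [norm_mul, Real.norm_of_nonneg (by positivity : 0 ≤ κ ^ (n + 1))]
  exact mul_le_of_le_one_right (by positivity) (Real.abs_sin_le_one _)

/-- The derivative `S'(ξ, ·)` with respect to `x ∈ [0,1]` (one-sided at the endpoints). -/
def S' (κ ξ x : ℝ) : ℝ := derivWithin (S κ ξ) (Icc 0 1) x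

/-- The vector `V(x) = (S(ξ,x) - S(η,x), S'(ξ,x) - S'(η,x))`, in the Euclidean plane. -/
def V (κ ξ η x : ℝ) : EuclideanSpace ℝ (Fin 2) :=
  !₂[S κ ξ x - S κ η x, S' κ ξ x - S' κ η x]

end Weierstrass

end

namespace Weierstrass

/-! On the unit square the second component of the `n`-th iterate is affine in `x` with slope `2⁻ⁿ`
(`iterate_baker`), so `S` is a sine series that can be differentiated term by term, with
coefficients decaying like `(κ/2)ⁿ`. If `ξ - η > 1/2`, the first digits are `1` and `0`, and the
first summands of the two differences are multiples of `sin (πx)` and `cos (πx)`, which are never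
small together. The second summand is estimated by hand and the rest by a geometric series
(`le_abs_S_sub`, `le_abs_S'_sub`). For `κ ≤ 0.55`, at every `x` one of the two first summands
dominates (`le_norm_V`); the case `η - ξ > 1/2` follows by symmetry. -/

/-- The doubling map on `(0, 1]`, fixing `0`. -/
noncomputable def doubling (t : ℝ) : ℝ := if 1 / 2 < t then 2 * t - 1 else 2 * t

theorem doubling_mem {t : ℝ} (ht : t ∈ Icc (0 : ℝ) 1) : doubling t ∈ Icc (0 : ℝ) 1 := by
  unfold doubling
  split_ifs with h
  · constructor <;> linarith [ht.2]
  · constructor <;> linarith [ht.1]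

/-- The first digit of `t`, as a real number. -/
noncomputable def headDigit (t : ℝ) : ℝ := if 1 / 2 < t then 1 else 0

/-- The value at `x = 0` of the second component of the `n`-th iterate of the baker's
transformation. -/
noncomputable def offset (ξ : ℝ) : ℕ → ℝ
  | 0 => 0
  | n + 1 => (headDigit (doubling^[n] ξ) + offset ξ n) / 2

theorem baker_eq_doubling {ξ x : ℝ} (hξ : ξ ∈ Icc (0 : ℝ) 1) (hx : x ∈ Icc (0 : ℝ) 1) :
    baker (ξ, x) = (doubling ξ, (headDigit ξ + x) / 2) := by
  rw [baker_eq hξ hx, doubling, headDigit]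
  split_ifs <;> simp [add_comm]

theorem iterate_doubling_mem {ξ : ℝ} (hξ : ξ ∈ Icc (0 : ℝ) 1) (n : ℕ) :
    doubling^[n] ξ ∈ Icc (0 : ℝ) 1 := by
  induction n with
  | zero => exact hξ
  | succ n ih => rw [Function.iterate_succ_apply']; exact doubling_mem ih

/-- The membership is carried through the induction because the formula for `baker` is valid only on
the unit square. -/
theorem iterate_baker {ξ x : ℝ} (hξ : ξ ∈ Icc (0 : ℝ) 1) (hx : x ∈ Icc (0 : ℝ) 1) (n : ℕ) :
    baker^[n] (ξ, x) = (doubling^[n] ξ, x / 2 ^ n + offset ξ n) ∧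
      x / 2 ^ n + offset ξ n ∈ Icc (0 : ℝ) 1 := by
  induction n with
  | zero => simpa [offset] using hx
  | succ n ih =>
    have e : (headDigit (doubling^[n] ξ) + (x / 2 ^ n + offset ξ n)) / 2
        = x / 2 ^ (n + 1) + offset ξ (n + 1) := by
      rw [offset, pow_succ]; field_simp; ring
    refine ⟨?_, ?_⟩
    · rw [Function.iterate_succ_apply', ih.1,
        baker_eq_doubling (iterate_doubling_mem hξ n) ih.2, e, Function.iterate_succ_apply']
    · rw [← e]
      have h := ih.2
      unfold headDigit
      split_ifs <;> constructor <;> linarith [h.1, h.2]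

/-- The argument of the `n`-th summand of `S`. -/
noncomputable def phase (ξ : ℝ) (n : ℕ) (x : ℝ) : ℝ := 2 * Real.pi * (x / 2 ^ (n + 1) + offset ξ (n + 1))

theorem S_eq {κ ξ x : ℝ} (hξ : ξ ∈ Icc (0 : ℝ) 1) (hx : x ∈ Icc (0 : ℝ) 1) :
    S κ ξ x = 2 * Real.pi * ∑' n : ℕ, κ ^ (n + 1) * Real.sin (phase ξ n x) := by
  simp only [S, phase, (iterate_baker hξ hx _).1]

/-! ### Tail estimate and termwise differentiation -/

theorem abs_tsum_sub_le {f : ℕ → ℝ} {C r : ℝ} (h0 : 0 ≤ r) (h1 : r < 1)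
    (hf : ∀ n, |f n| ≤ C * r ^ (n + 1)) :
    |∑' n, f n - (f 0 + f 1)| ≤ C * r ^ 3 / (1 - r) := by
  have hg := hasSum_geometric_of_lt_one h0 h1
  have hs : Summable f := by
    refine Summable.of_norm_bounded ((hg.mul_left (C * r)).summable) fun n => ?_
    refine (hf n).trans_eq ?_
    ring
  have h2 := hs.sum_add_tsum_nat_add 2
  rw [Finset.sum_range_succ, Finset.sum_range_one] at h2
  rw [← h2, add_sub_cancel_left, div_eq_mul_inv]
  refine tsum_of_norm_bounded (f := fun n => f (n + 2)) (hg.mul_left (C * r ^ 3)) fun n => ?_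
  refine (hf (n + 2)).trans_eq ?_
  ring

theorem summable_sin {κ : ℝ} (h0 : 0 < κ) (h1 : κ < 1) (ξ x : ℝ) :
    Summable fun n : ℕ => κ ^ (n + 1) * Real.sin (phase ξ n x) := by
  refine Summable.of_norm_bounded
    ((summable_nat_add_iff 1).2 (summable_geometric_of_lt_one h0.le h1)) fun n => ?_
  rw [norm_mul, Real.norm_of_nonneg (by positivity : 0 ≤ κ ^ (n + 1))]
  exact mul_le_of_le_one_right (by positivity) (Real.abs_sin_le_one _)

theorem abs_cos_term_le {κ : ℝ} (h0 : 0 < κ) (ξ x : ℝ) (n : ℕ) :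
    |(κ / 2) ^ (n + 1) * Real.cos (phase ξ n x)| ≤ (κ / 2) ^ (n + 1) := by
  rw [abs_mul, abs_of_nonneg (by positivity : 0 ≤ (κ / 2) ^ (n + 1))]
  exact mul_le_of_le_one_right (by positivity) (Real.abs_cos_le_one _)

theorem summable_cos {κ : ℝ} (h0 : 0 < κ) (h1 : κ < 1) (ξ x : ℝ) :
    Summable fun n : ℕ => (κ / 2) ^ (n + 1) * Real.cos (phase ξ n x) :=
  Summable.of_norm_bounded ((summable_nat_add_iff 1).2
    (summable_geometric_of_lt_one (r := κ / 2) (by positivity) (by linarith)))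
    (abs_cos_term_le h0 ξ x)

theorem hasDerivAt_tsum_sin {κ : ℝ} (h0 : 0 < κ) (h1 : κ < 1) (ξ x : ℝ) :
    HasDerivAt (fun x => ∑' n : ℕ, κ ^ (n + 1) * Real.sin (phase ξ n x))
      (2 * Real.pi * ∑' n : ℕ, (κ / 2) ^ (n + 1) * Real.cos (phase ξ n x)) x := by
  rw [← tsum_mul_left]
  have hu : Summable fun n : ℕ => 2 * Real.pi * (κ / 2) ^ (n + 1) :=
    ((summable_nat_add_iff 1).2 (summable_geometric_of_lt_one (r := κ / 2)
      (by positivity) (by linarith))).mul_left _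
  refine hasDerivAt_tsum (g := fun n y => κ ^ (n + 1) * Real.sin (phase ξ n y))
    (g' := fun n y => 2 * Real.pi * ((κ / 2) ^ (n + 1) * Real.cos (phase ξ n y)))
    hu (fun n y => ?_) (fun n y => ?_) (summable_sin h0 h1 ξ 0) x
  · have hp : HasDerivAt (phase ξ n) (2 * Real.pi * (1 / 2 ^ (n + 1))) y :=
      (((hasDerivAt_id y).div_const _).add_const _).const_mul _
    refine (hp.sin.const_mul (κ ^ (n + 1))).congr_deriv ?_
    rw [div_pow]; ring
  · rw [norm_mul, Real.norm_of_nonneg (by positivity : 0 ≤ 2 * Real.pi)]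
    exact mul_le_mul_of_nonneg_left (abs_cos_term_le h0 ξ y n) (by positivity)

/-- The sine series is differentiable on all of `ℝ`, but its identification with `S` is available on
`[0,1]`; hence the derivative within the interval. -/
theorem hasDerivWithinAt_S {κ ξ x : ℝ} (h0 : 0 < κ) (h1 : κ < 1) (hξ : ξ ∈ Icc (0 : ℝ) 1)
    (hx : x ∈ Icc (0 : ℝ) 1) :
    HasDerivWithinAt (S κ ξ) (2 * Real.pi *
      (2 * Real.pi * ∑' n : ℕ, (κ / 2) ^ (n + 1) * Real.cos (phase ξ n x))) (Icc 0 1) x :=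
  ((hasDerivAt_tsum_sin h0 h1 ξ x).const_mul (2 * Real.pi)).hasDerivWithinAt.congr
    (fun _ hy => S_eq hξ hy) (S_eq hξ hx)

theorem S'_eq {κ ξ x : ℝ} (h0 : 0 < κ) (h1 : κ < 1) (hξ : ξ ∈ Icc (0 : ℝ) 1)
    (hx : x ∈ Icc (0 : ℝ) 1) :
    S' κ ξ x = 2 * Real.pi *
      (2 * Real.pi * ∑' n : ℕ, (κ / 2) ^ (n + 1) * Real.cos (phase ξ n x)) :=
  (hasDerivWithinAt_S h0 h1 hξ hx).derivWithin (uniqueDiffOn_Icc one_pos x hx)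

/-! ### Lower bounds from the first two summands -/

theorem phase_zero (ξ x : ℝ) : phase ξ 0 x = Real.pi * x + headDigit ξ * Real.pi := by
  simp only [phase, offset, Function.iterate_zero, id]; ring

theorem phase_one (ξ x : ℝ) : phase ξ 1 x
    = Real.pi * x / 2 + headDigit ξ * (Real.pi / 2) + headDigit (doubling ξ) * Real.pi := by
  simp only [phase, offset, Function.iterate_zero, Function.iterate_one, id]; ring

/-- Lower bound for the difference of the values, from its first two summands. -/
theorem le_abs_S_sub {κ ξ η x : ℝ} (h0 : 0 < κ) (h1 : κ < 1) (hξ : ξ ∈ Icc (0 : ℝ) 1)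
    (hη : η ∈ Icc (0 : ℝ) 1) (hx : x ∈ Icc (0 : ℝ) 1) (h : 1 / 2 < ξ - η) :
    2 * Real.pi * κ * (2 * Real.sin (Real.pi * x) - κ - 2 * κ ^ 2 / (1 - κ))
      ≤ |S κ ξ x - S κ η x| := by
  have dξ : headDigit ξ = 1 := if_pos (by linarith [hη.1])
  have dη : headDigit η = 0 := if_neg (by linarith [hξ.2])
  have tξ : doubling ξ = 2 * ξ - 1 := if_pos (by linarith [hη.1])
  have tη : doubling η = 2 * η := if_neg (by linarith [hξ.2])
  set f : ℕ → ℝ := fun n => κ ^ (n + 1) * (Real.sin (phase ξ n x) - Real.sin (phase η n x))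
    with hf
  have hS : S κ ξ x - S κ η x = 2 * Real.pi * ∑' n, f n := by
    rw [S_eq hξ hx, S_eq hη hx, ← mul_sub,
      ← (summable_sin h0 h1 ξ x).tsum_sub (summable_sin h0 h1 η x)]
    simp only [hf, mul_sub]
  have ht := abs_tsum_sub_le (f := f) (C := 2) h0.le h1 fun n => by
    rw [abs_mul, abs_of_nonneg (by positivity : 0 ≤ κ ^ (n + 1)), mul_comm]
    refine mul_le_mul_of_nonneg_right ?_ (by positivity)
    have := Real.abs_sin_le_one (phase ξ n x)
    have := Real.abs_sin_le_one (phase η n x)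
    exact (abs_sub _ _).trans (by linarith)
  have f0 : f 0 = -(κ * (2 * Real.sin (Real.pi * x))) := by
    simp only [hf, phase_zero, dξ, dη, one_mul, zero_mul, add_zero, Real.sin_add_pi]; ring
  have hpx : 0 ≤ Real.pi * x := mul_nonneg Real.pi_pos.le hx.1
  have hpx' : Real.pi * x ≤ Real.pi := mul_le_of_le_one_right Real.pi_pos.le hx.2
  have hs : 0 ≤ Real.sin (Real.pi * x / 2) :=
    Real.sin_nonneg_of_nonneg_of_le_pi (by linarith) (by linarith)
  have hc : 0 ≤ Real.cos (Real.pi * x / 2) :=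
    Real.cos_nonneg_of_neg_pi_div_two_le_of_le (by linarith) (by linarith)
  have hs1 := Real.sin_le_one (Real.pi * x / 2)
  have hc1 := Real.cos_le_one (Real.pi * x / 2)
  -- Since `f 0 ≤ 0`, only an upper bound on `f 1` is needed. From `2 * ξ - 1 > 2 * η`, the second
  -- digits cannot be `0` for `ξ` and `1` for `η`, the one case in which `sin + cos`, as large as
  -- `√2`, would appear.
  have f1 : f 1 ≤ κ ^ 2 := by
    simp only [hf, phase_one, dξ, dη, tξ, tη, one_mul, zero_mul, add_zero]
    refine mul_le_of_le_one_right (by positivity) ?_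
    unfold headDigit
    split_ifs
    · simp only [one_mul, Real.sin_add_pi, Real.sin_add_pi_div_two]; linarith
    · simp only [one_mul, zero_mul, add_zero, Real.sin_add_pi, Real.sin_add_pi_div_two]; linarith
    · linarith
    · simp only [zero_mul, add_zero, Real.sin_add_pi_div_two]; linarith
  have hle : κ * (2 * Real.sin (Real.pi * x) - κ - 2 * κ ^ 2 / (1 - κ)) ≤ |∑' n, f n| := by
    have e : κ * (2 * Real.sin (Real.pi * x) - κ - 2 * κ ^ 2 / (1 - κ))
        = κ * (2 * Real.sin (Real.pi * x)) - κ ^ 2 - 2 * κ ^ 3 / (1 - κ) := by ring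
    rw [e]
    linarith [(abs_le.1 ht).2, neg_abs_le (∑' n, f n)]
  rw [hS, abs_mul, abs_of_nonneg (by positivity : 0 ≤ 2 * Real.pi), mul_assoc]
  exact mul_le_mul_of_nonneg_left hle (by positivity)

/-- Lower bound for the difference of the derivatives, from its first two summands. -/
theorem le_abs_S'_sub {κ ξ η x : ℝ} (h0 : 0 < κ) (h1 : κ < 1) (hξ : ξ ∈ Icc (0 : ℝ) 1)
    (hη : η ∈ Icc (0 : ℝ) 1) (hx : x ∈ Icc (0 : ℝ) 1) (h : 1 / 2 < ξ - η) :
    2 * Real.pi * (2 * Real.pi * κ *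
      (|Real.cos (Real.pi * x)| - κ * (√2 / 4) - κ ^ 2 / 4 / (1 - κ / 2)))
      ≤ |S' κ ξ x - S' κ η x| := by
  have dξ : headDigit ξ = 1 := if_pos (by linarith [hη.1])
  have dη : headDigit η = 0 := if_neg (by linarith [hξ.2])
  set f : ℕ → ℝ := fun n =>
    (κ / 2) ^ (n + 1) * (Real.cos (phase ξ n x) - Real.cos (phase η n x)) with hf
  have hS : S' κ ξ x - S' κ η x = 2 * Real.pi * (2 * Real.pi * ∑' n, f n) := by
    rw [S'_eq h0 h1 hξ hx, S'_eq h0 h1 hη hx, ← mul_sub, ← mul_sub,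
      ← (summable_cos h0 h1 ξ x).tsum_sub (summable_cos h0 h1 η x)]
    simp only [hf, mul_sub]
  have ht := abs_tsum_sub_le (f := f) (C := 2) (r := κ / 2) (by positivity) (by linarith)
    fun n => by
      rw [abs_mul, abs_of_nonneg (by positivity : 0 ≤ (κ / 2) ^ (n + 1)), mul_comm]
      refine mul_le_mul_of_nonneg_right ?_ (by positivity)
      have := Real.abs_cos_le_one (phase ξ n x)
      have := Real.abs_cos_le_one (phase η n x)
      exact (abs_sub _ _).trans (by linarith)
  have f0 : f 0 = -(κ * Real.cos (Real.pi * x)) := by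
    simp only [hf, phase_zero, dξ, dη, one_mul, zero_mul, add_zero, Real.cos_add_pi]; ring
  have hsq := Real.sin_sq_add_cos_sq (Real.pi * x / 2)
  -- For any second digits the cosine difference is `±sin ± cos` at `πx/2`, whose square is at most
  -- `2`.
  have f1 : |f 1| ≤ (κ / 2) ^ 2 * √2 := by
    simp only [hf, phase_one, dξ, dη, one_mul, zero_mul, add_zero]
    rw [abs_mul, abs_of_nonneg (by positivity : 0 ≤ (κ / 2) ^ (1 + 1))]
    refine mul_le_mul_of_nonneg_left (Real.abs_le_sqrt ?_) (by positivity)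
    have hp := sq_nonneg (Real.sin (Real.pi * x / 2) + Real.cos (Real.pi * x / 2))
    have hm := sq_nonneg (Real.sin (Real.pi * x / 2) - Real.cos (Real.pi * x / 2))
    unfold headDigit
    split_ifs <;> simp only [one_mul, zero_mul, add_zero, Real.cos_add_pi,
      Real.cos_add_pi_div_two] <;> linarith
  have hle : κ * (|Real.cos (Real.pi * x)| - κ * (√2 / 4) - κ ^ 2 / 4 / (1 - κ / 2))
      ≤ |∑' n, f n| := by
    have e : κ * (|Real.cos (Real.pi * x)| - κ * (√2 / 4) - κ ^ 2 / 4 / (1 - κ / 2))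
        = |f 0| - (κ / 2) ^ 2 * √2 - 2 * (κ / 2) ^ 3 / (1 - κ / 2) := by
      rw [f0, abs_neg, abs_mul, abs_of_pos h0]; ring
    rw [e]
    have t : |f 0| ≤ |∑' n, f n| + |∑' n, f n - (f 0 + f 1)| + |f 1| := by
      calc |f 0| = |∑' n, f n - (∑' n, f n - (f 0 + f 1)) - f 1| := by congr 1; ring
        _ ≤ _ := (abs_sub _ _).trans (by gcongr; exact abs_sub _ _)
    linarith
  rw [hS, abs_mul (2 * Real.pi), abs_mul (2 * Real.pi), abs_of_nonneg (by positivity : 0 ≤ 2 * Real.pi),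
    mul_assoc (2 * Real.pi) κ]
  gcongr

/-! ### Combining the two bounds -/

theorem abs_S_sub_le_norm_V (κ ξ η x : ℝ) : |S κ ξ x - S κ η x| ≤ ‖V κ ξ η x‖ := by
  simpa [V] using PiLp.norm_apply_le (V κ ξ η x) 0

theorem abs_S'_sub_le_norm_V (κ ξ η x : ℝ) : |S' κ ξ x - S' κ η x| ≤ ‖V κ ξ η x‖ := by
  simpa [V] using PiLp.norm_apply_le (V κ ξ η x) 1

theorem norm_V_comm (κ ξ η x : ℝ) : ‖V κ ξ η x‖ = ‖V κ η ξ x‖ := by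
  simp [V, EuclideanSpace.norm_eq, sub_sq_comm (S κ ξ x), sub_sq_comm (S' κ ξ x)]

theorem le_norm_V {κ ξ η x : ℝ} (h0 : 0 < κ) (hκ : κ ≤ 0.55) (hξ : ξ ∈ Icc (0 : ℝ) 1)
    (hη : η ∈ Icc (0 : ℝ) 1) (hx : x ∈ Icc (0 : ℝ) 1) (h : 1 / 2 < ξ - η) :
    2 * Real.pi * κ * 0.005 ≤ ‖V κ ξ η x‖ := by
  norm_num at hκ
  have h1 : κ < 1 := by linarith
  have hpx : 0 ≤ Real.sin (Real.pi * x) := Real.sin_nonneg_of_nonneg_of_le_pi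
    (mul_nonneg Real.pi_pos.le hx.1) (mul_le_of_le_one_right Real.pi_pos.le hx.2)
  -- As `0.31² + 0.95² < 1`, failure of this inequality forces `sin (πx) ≥ 0.95`. The subtracted
  -- terms grow with `κ`; at `κ = 0.55` both brackets still exceed `0.005`, narrowly for the sine.
  by_cases hc : 0.31 ≤ |Real.cos (Real.pi * x)|
  · refine le_trans ?_ ((le_abs_S'_sub h0 h1 hξ hη hx h).trans (abs_S'_sub_le_norm_V κ ξ η x))
    have hr : √2 < 1.415 := by
      rw [Real.sqrt_lt' (by norm_num)]; norm_num
    have ha : κ * (√2 / 4) ≤ 0.55 * (1.415 / 4) := by norm_num at hr ⊢; nlinarith [Real.sqrt_nonneg 2]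
    have hb : κ ^ 2 / 4 / (1 - κ / 2) ≤ 0.105 := by
      rw [div_le_iff₀ (by linarith)]; nlinarith
    have hd : 2 * Real.pi * κ * 0.005 ≤ 2 * Real.pi * κ *
        (|Real.cos (Real.pi * x)| - κ * (√2 / 4) - κ ^ 2 / 4 / (1 - κ / 2)) := by
      refine mul_le_mul_of_nonneg_left ?_ (by positivity)
      norm_num at hc ha hb ⊢; linarith
    -- The derivative bound has an extra factor `2π`, which is discarded to reach the common
    -- constant.
    have hp : 1 ≤ 2 * Real.pi := by linarith [Real.pi_gt_three]
    exact hd.trans (le_mul_of_one_le_left (le_trans (by positivity) hd) hp)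
  · refine le_trans ?_ ((le_abs_S_sub h0 h1 hξ hη hx h).trans (abs_S_sub_le_norm_V κ ξ η x))
    have hs : 0.95 ≤ Real.sin (Real.pi * x) := by
      have h2 : Real.cos (Real.pi * x) ^ 2 ≤ 0.31 ^ 2 := sq_le_sq' (by
        linarith [neg_abs_le (Real.cos (Real.pi * x))]) (by
        linarith [le_abs_self (Real.cos (Real.pi * x))])
      refine abs_le_of_sq_le_sq' ?_ hpx |>.2
      have := Real.sin_sq_add_cos_sq (Real.pi * x)
      norm_num at h2 ⊢; linarith
    have hb : 2 * κ ^ 2 / (1 - κ) ≤ 1.3445 := by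
      rw [div_le_iff₀ (by linarith)]; nlinarith
    refine mul_le_mul_of_nonneg_left ?_ (by positivity)
    norm_num at hs hb ⊢; linarith

end Weierstrass

theorem proposition4p1 :
    ∃ κ₀ ∈ Set.Icc (0.55 : ℝ) 0.56, ∀ κ : ℝ, 0 < κ → κ ≤ κ₀ →
      (∀ ξ ∈ Set.Icc (0 : ℝ) 1, DifferentiableOn ℝ (Weierstrass.S κ ξ) (Set.Icc 0 1)) ∧
      ∃ c : ℝ, 0 < c ∧ ∀ ξ ∈ Set.Icc (0 : ℝ) 1, ∀ η ∈ Set.Icc (0 : ℝ) 1, (1 / 2 : ℝ) < |ξ - η| →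
        c ≤ ⨅ x : Set.Icc (0 : ℝ) 1, ‖Weierstrass.V κ ξ η (x : ℝ)‖ := by
  refine ⟨0.55, by norm_num, fun κ h0 hκ => ?_⟩
  have h1 : κ < 1 := by norm_num at hκ; linarith
  refine ⟨fun ξ hξ x hx => (Weierstrass.hasDerivWithinAt_S h0 h1 hξ hx).differentiableWithinAt,
    2 * Real.pi * κ * 0.005, by positivity, fun ξ hξ η hη h => ?_⟩
  have : Nonempty (Set.Icc (0 : ℝ) 1) := ⟨⟨0, by simp⟩⟩
  refine le_ciInf fun x => ?_
  rcases lt_abs.1 h with h | h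
  · exact Weierstrass.le_norm_V h0 hκ hξ hη x.2 h
  · rw [Weierstrass.norm_V_comm]
    exact Weierstrass.le_norm_V h0 hκ hη hξ x.2 (by linarith)
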